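/- Let $G$ be a finite group acting on a finite set $\Omega$ and let $p$ be a prime. Say that $G$ has Property $(*)_p$ on $\Omega$ if, for every Sylow $p$-subgroup $P$ of $G$ and every $\omega\in\Omega$, the stabiliser $P_\omega$ is a Sylow $p$-subgroup of $G_\omega$. A primitive permutation group $G$ on a finite set $\Omega$ is of *twisted wreath type* (as in the O'Nan–Scott Theorem of Liebeck, Praeger and Saxl) if there are an integer $k\geq 2$, a finite nonabelian simple group $T$, a transitive permutation group $P\leqslant S_k$ with a point stabiliser $Q$, and a homomorphism $\varphi:Q\to\operatorname{Aut}(T)$ with $\operatorname{Inn}(T)\leqslant\varphi(Q)$, such that $G$ can be identified with the twisted wreath product $T\,\mathrm{twr}_\varphi\,P=B\rtimes P$ so that $G_\omega=P$ for some $\omega\in\Omega$. Here $$B=\{f:P\to T \mid f(xq)=f(x)^{\varphi(q)}\text{ for all }x\in P,\ q\in Q\}$$ is a group under pointwise multiplication, and $P$ acts on $B$ by $f^{y}(x)=f(yx)$ for $x,y\in P$. **Theorem.** Let $G$ be a primitive permutation group of twisted wreath type on a finite set $\Omega$, and let $p$ be a prime dividing $|\Omega|$. Then $G$ does not have Property $(*)_p$.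 -/

import Mathlib

/-- `G` acting on `Ω` has Property `(*)_p`: for every Sylow `p`-subgroup `P` of `G` and every point
`ω`, the point stabiliser `P_ω = P ∩ G_ω` is a Sylow `p`-subgroup of `G_ω`. -/
def HasPropertyStar (p : ℕ) (G : Type*) (Ω : Type*) [Group G] [MulAction G Ω] : Prop :=
  ∀ (P : Sylow p G) (ω : Ω), ∃ S : Sylow p (MulAction.stabilizer G ω),
    (S : Subgroup (MulAction.stabilizer G ω)) =
      (P : Subgroup G).subgroupOf (MulAction.stabilizer G ω)

namespace TwistedWreath

/-- The base group of the twisted wreath product `T twr_φ P`, where `φ : Q → Aut T` and `Q ≤ P`: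
the functions `f : P → T` with `f (x q) = f(x) ^ φ(q)` for all `x ∈ P` and `q ∈ Q`, under pointwise
multiplication. Automorphisms act on the left here, so the right action `t ^ α` is `α⁻¹ t`. -/
def base {T P : Type*} [Group T] [Group P] {Q : Subgroup P} (φ : Q →* MulAut T) :
    Subgroup (P → T) where
  carrier := {f | ∀ (x : P) (q : Q), f (x * q) = (φ q)⁻¹ (f x)}
  one_mem' := by intro x q; simp
  mul_mem' := by
    intro f g hf hg x q
    simp only [Pi.mul_apply, map_mul]
    rw [hf x q, hg x q]
  inv_mem' := by
    intro f hf x q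
    simp only [Pi.inv_apply, map_inv]
    rw [hf x q]

/-- The action of `P` on the base group by translation of the argument, `(p • f) x = f (p⁻¹ x)`. -/
def translation {T P : Type*} [Group T] [Group P] {Q : Subgroup P} (φ : Q →* MulAut T) :
    P →* MulAut (base φ) where
  toFun p :=
    { toFun := fun f => ⟨fun x => f.1 (p⁻¹ * x), fun x q => by
        beta_reduce; rw [← mul_assoc]; exact f.2 (p⁻¹ * x) q⟩
      invFun := fun f => ⟨fun x => f.1 (p * x), fun x q => by
        beta_reduce; rw [← mul_assoc]; exact f.2 (p * x) q⟩
      left_inv := fun f => by ext x; simp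
      right_inv := fun f => by ext x; simp
      map_mul' := fun f g => rfl }
  map_one' := by ext f x; simp
  map_mul' p r := by ext f x; simp [mul_assoc]

end TwistedWreath

/-- The twisted wreath product `T twr_φ P`: the semidirect product of the base group by `P`. -/
abbrev TwistedWreathProduct {T P : Type*} [Group T] [Group P] {Q : Subgroup P}
    (φ : Q →* MulAut T) : Type _ :=
  SemidirectProduct (TwistedWreath.base φ) P (TwistedWreath.translation φ)

/-- `G` is a primitive permutation group of twisted wreath type on `Ω`, in the sense of the
O'Nan-Scott theorem of Liebeck, Praeger and Saxl: `G` acts faithfully and primitively on `Ω`, and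
there are `k ≥ 2`, a nonabelian simple group `T`, a transitive group `P` of permutations of `k`
points with point stabiliser `Q`, and a homomorphism `φ : Q → Aut T` whose image contains `Inn T`,
such that `G` can be identified with the twisted wreath product `T twr_φ P` in such a way that the
stabiliser of some point of `Ω` is the top group `P`. -/
def IsPrimitiveOfTwistedWreathType.{u, v} (G : Type u) (Ω : Type v) [Group G] [MulAction G Ω] :
    Prop :=
  FaithfulSMul G Ω ∧ MulAction.IsPreprimitive G Ω ∧
  ∃ (k : ℕ) (_ : 2 ≤ k) (T : Type u) (_ : Group T) (P : Subgroup (Equiv.Perm (Fin k)))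
    (i : Fin k) (φ : MulAction.stabilizer P i →* MulAut T),
    IsSimpleGroup T ∧ (∃ a b : T, a * b ≠ b * a) ∧
    MulAction.IsPretransitive P (Fin k) ∧
    (MulAut.conj : T →* MulAut T).range ≤ φ.range ∧
    ∃ (e : G ≃* TwistedWreathProduct φ) (ω : Ω),
      (MulAction.stabilizer G ω).map e.toMonoidHom =
        (SemidirectProduct.inr : P →* TwistedWreathProduct φ).range

/-! Write `B` for the base group. Orbit-stabiliser gives `|Ω| = |B|`, so `p` divides `|T|`, hence
`|P|`, and `P` has an element `r` of order `p`. Let `S` be a Sylow `p`-subgroup of `G` containing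
`r`. For `b ∈ B`, Property `(*)_p` at `b • ω`, whose stabiliser is `b P b⁻¹`, puts `b r b⁻¹` in `S`
(`HasPropertyStar.exists_mem_stabilizer`), so the commutator `[b, r]` lies in the `p`-group `S ∩ B`.
These commutators even lie in its normal core in `B`, which is trivial since `B` projects onto the
nonabelian simple group `T` in every coordinate. So `r` centralises `B`, hence lies in every
conjugate of `Q`, and `r = 1` because `P` is faithful on the `k` points: a contradiction. -/

/-- Under Property `(*)_p`, an element of a Sylow `p`-subgroup `S` agrees, modulo the kernel of an
epimorphism that is still onto on the stabiliser of `ω`, with an element of `S` fixing `ω`. -/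
theorem HasPropertyStar.exists_mem_stabilizer {p : ℕ} [Fact p.Prime] {G Ω P : Type*} [Group G]
    [Finite G] [MulAction G Ω] [Group P] (h : HasPropertyStar p G Ω) (f : G →* P)
    (ω : Ω) (hω : ∀ y : P, ∃ g ∈ MulAction.stabilizer G ω, f g = y)
    (S : Sylow p G) {r : G} (hr : r ∈ S) : ∃ s ∈ S, s • ω = ω ∧ f s = f r := by
  have hf : Function.Surjective f := fun y => (hω y).imp fun g hg => hg.2
  obtain ⟨S', hS'⟩ := h S ω
  have hf' : Function.Surjective (f.comp (MulAction.stabilizer G ω).subtype) := fun y => by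
    obtain ⟨g, hg, rfl⟩ := hω y
    exact ⟨⟨g, hg⟩, rfl⟩
  have hle : ((S'.mapSurjective hf' : Sylow p P) : Subgroup P) ≤ S.mapSurjective hf := by
    rw [Sylow.coe_mapSurjective, Sylow.coe_mapSurjective, hS']
    rintro _ ⟨g, hg, rfl⟩
    exact ⟨g, Subgroup.mem_subgroupOf.1 hg, rfl⟩
  -- Epimorphisms carry Sylow subgroups to Sylow subgroups, so both images are Sylow in `P` and the
  -- inclusion is an equality.
  have heq := (S'.mapSurjective hf').is_maximal' (S.mapSurjective hf).isPGroup' hle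
  have hmem : f r ∈ ((S.mapSurjective hf : Sylow p P) : Subgroup P) := by
    rw [Sylow.coe_mapSurjective]
    exact ⟨r, hr, rfl⟩
  rw [heq, Sylow.coe_mapSurjective, hS'] at hmem
  obtain ⟨g, hg, hgr⟩ := hmem
  exact ⟨g, Subgroup.mem_subgroupOf.1 hg, g.2, hgr⟩

/-- Otherwise `T` is a `p`-group, with nontrivial centre, and simplicity makes it abelian. -/
theorem IsSimpleGroup.normal_isPGroup_eq_bot {p : ℕ} [Fact p.Prime] {T : Type*} [Group T]
    [Finite T] [IsSimpleGroup T] (hT : ∃ a b : T, a * b ≠ b * a) (N : Subgroup T) [hN : N.Normal]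
    (hp : IsPGroup p N) : N = ⊥ := by
  refine hN.eq_bot_or_eq_top.resolve_right ?_
  rintro rfl
  have hT' : IsPGroup p T := hp.of_equiv Subgroup.topEquiv
  have := hT'.center_nontrivial
  obtain ⟨a, b, hab⟩ := hT
  rcases (inferInstance : (Subgroup.center T).Normal).eq_bot_or_eq_top with h | h
  · exact (Subgroup.nontrivial_iff_ne_bot _).1 this h
  · exact hab ((Subgroup.mem_center_iff.1 (h ▸ Subgroup.mem_top b : b ∈ Subgroup.center T)) a)

theorem IsSimpleGroup.conj_injective {T : Type*} [Group T] [IsSimpleGroup T]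
    (hT : ∃ a b : T, a * b ≠ b * a) : Function.Injective (MulAut.conj : T →* MulAut T) := by
  rw [← MonoidHom.ker_eq_bot_iff]
  refine (inferInstance : (MulAut.conj : T →* MulAut T).ker.Normal).eq_bot_or_eq_top.resolve_right
    fun h => ?_
  obtain ⟨a, b, hab⟩ := hT
  have ha : MulAut.conj a = 1 := MonoidHom.mem_ker.1 (h ▸ Subgroup.mem_top a)
  have := DFunLike.congr_fun ha b
  rw [MulAut.conj_apply, MulAut.one_apply, mul_inv_eq_iff_eq_mul] at this
  exact hab this

namespace TwistedWreath

variable {T P : Type*} [Group T] [Group P] {Q : Subgroup P}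

open Classical in
/-- The element of the base group supported on the coset `xQ` with value `t` at `x`. -/
noncomputable def single (φ : Q →* MulAut T) (x : P) (t : T) : base φ :=
  ⟨fun y => if h : x⁻¹ * y ∈ Q then (φ ⟨x⁻¹ * y, h⟩)⁻¹ t else 1, by
    intro y q
    have hiff : x⁻¹ * (y * q) ∈ Q ↔ x⁻¹ * y ∈ Q := by
      rw [← mul_assoc]; exact Subgroup.mul_mem_cancel_right _ q.2
    by_cases h : x⁻¹ * y ∈ Q
    · have h' := hiff.2 h
      have e : (⟨x⁻¹ * (y * q), h'⟩ : Q) = ⟨x⁻¹ * y, h⟩ * q := by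
        ext; simp [mul_assoc]
      simp only [dif_pos h, dif_pos h', e, map_mul, mul_inv_rev, MulAut.mul_apply]
    · simp only [dif_neg h, dif_neg (mt hiff.1 h), map_one]⟩

theorem single_apply_self (φ : Q →* MulAut T) (x : P) (t : T) : (single φ x t).1 x = t := by
  have h : x⁻¹ * x ∈ Q := by simp
  have e : (⟨x⁻¹ * x, h⟩ : Q) = 1 := by ext; simp
  simp only [single, dif_pos h, e, map_one, inv_one, MulAut.one_apply]

theorem single_apply_of_notMem (φ : Q →* MulAut T) {x y : P} (t : T) (h : x⁻¹ * y ∉ Q) :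
    (single φ x t).1 y = 1 := by
  simp only [single, dif_neg h]

/-- Evaluation of the elements of the base group at `x`. -/
def eval (φ : Q →* MulAut T) (x : P) : base φ →* T :=
  (Pi.evalMonoidHom (fun _ : P => T) x).comp (base φ).subtype

theorem eval_surjective (φ : Q →* MulAut T) (x : P) : Function.Surjective (eval φ x) :=
  fun t => ⟨single φ x t, single_apply_self φ x t⟩

/-- Evaluation at each `x` maps `N` to a normal `p`-subgroup of `T`, which is trivial. -/
theorem normal_isPGroup_eq_bot {p : ℕ} [Fact p.Prime] [Finite T] [IsSimpleGroup T]
    (hT : ∃ a b : T, a * b ≠ b * a) (φ : Q →* MulAut T) (N : Subgroup (base φ)) [hN : N.Normal]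
    (hp : IsPGroup p N) : N = ⊥ := by
  rw [eq_bot_iff]
  intro b hb
  rw [Subgroup.mem_bot]
  ext x
  have := hN.map (eval φ x) (eval_surjective φ x)
  have h := IsSimpleGroup.normal_isPGroup_eq_bot hT (N.map (eval φ x)) (hp.map _)
  have hx : eval φ x b ∈ N.map (eval φ x) := ⟨b, hb, rfl⟩
  rwa [h, Subgroup.mem_bot] at hx

/-- Translation by `r` moves the support `xQ` of `single φ x t` to `rxQ`, so these cosets coincide.
-/
theorem mem_of_translation_eq_one [Nontrivial T] (φ : Q →* MulAut T) {r : P}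
    (hr : translation φ r = 1) (x : P) : x⁻¹ * r * x ∈ Q := by
  by_contra h
  obtain ⟨t, ht⟩ := exists_ne (1 : T)
  have h' : x⁻¹ * (r⁻¹ * x) ∉ Q := fun h' => h (by
    have := Q.inv_mem h'
    simpa [mul_assoc] using this)
  have h1 : (single φ x t).1 (r⁻¹ * x) = (single φ x t).1 x :=
    congrFun (congrArg Subtype.val (DFunLike.congr_fun hr (single φ x t))) x
  rw [single_apply_of_notMem φ t h', single_apply_self] at h1
  exact ht h1.symm

/-- `T ≅ Inn T` is a subgroup of a quotient of the subgroup `Q` of `P`. -/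
theorem card_dvd_card_of_conj_range_le [IsSimpleGroup T] (hT : ∃ a b : T, a * b ≠ b * a)
    (φ : Q →* MulAut T) (hφ : (MulAut.conj : T →* MulAut T).range ≤ φ.range) :
    Nat.card T ∣ Nat.card P := by
  rw [Nat.card_congr (MonoidHom.ofInjective (IsSimpleGroup.conj_injective hT)).toEquiv]
  exact (Subgroup.card_dvd_of_le hφ).trans
    ((Subgroup.card_range_dvd φ).trans (Subgroup.card_subgroup_dvd_card Q))

/-- If a twisted wreath product acts with point stabiliser the top group and has Property `(*)_p`,
then the elements of the top group of `p`-power order centralise the base group. -/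
theorem translation_eq_one_of_hasPropertyStar {p : ℕ} [Fact p.Prime] {G Ω : Type*} [Group G]
    [Finite G] [MulAction G Ω] [Finite T] [IsSimpleGroup T] (hT : ∃ a b : T, a * b ≠ b * a)
    (φ : Q →* MulAut T) (e : G ≃* TwistedWreathProduct φ) (ω : Ω)
    (hω : (MulAction.stabilizer G ω).map e.toMonoidHom =
      (SemidirectProduct.inr : P →* TwistedWreathProduct φ).range)
    (hstar : HasPropertyStar p G Ω) {r : P} (hr : ∃ n, r ^ p ^ n = 1) :
    translation φ r = 1 := by
  have hstab : ∀ g : G, g • ω = ω ↔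
      e g ∈ (SemidirectProduct.inr : P →* TwistedWreathProduct φ).range := by
    intro g
    rw [← hω]
    constructor
    · exact fun h => ⟨g, h, rfl⟩
    · rintro ⟨g', hg', h⟩
      rw [← e.injective h]
      exact hg'
  let f : G →* P := SemidirectProduct.rightHom.comp e.toMonoidHom
  have hp : IsPGroup p (Subgroup.zpowers (e.symm (SemidirectProduct.inr r))) := by
    obtain ⟨n, hn⟩ := hr
    refine IsPGroup.of_card_dvd_pow (n := n) ?_
    rw [Nat.card_zpowers]
    apply orderOf_dvd_of_pow_eq_one
    rw [← map_pow, ← map_pow, hn, map_one, map_one]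
  obtain ⟨S, hS⟩ := hp.exists_le_sylow
  have hrS : e.symm (SemidirectProduct.inr r) ∈ S := hS (Subgroup.mem_zpowers _)
  let ι : base φ →* G := e.symm.toMonoidHom.comp SemidirectProduct.inl
  have hι : Function.Injective ι := e.symm.injective.comp SemidirectProduct.inl_injective
  let D : Subgroup (base φ) := (S : Subgroup G).comap ι
  have hD : IsPGroup p D := S.isPGroup'.comap_of_injective ι hι
  have key : ∀ b : base φ, b * (translation φ r b)⁻¹ ∈ D := by
    intro b
    have hsurj : ∀ y : P, ∃ g ∈ MulAction.stabilizer G (ι b • ω), f g = y := by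
      intro y
      refine ⟨ι b * e.symm (SemidirectProduct.inr y) * (ι b)⁻¹, ?_, ?_⟩
      · rw [MulAction.mem_stabilizer_iff, mul_smul, mul_smul, inv_smul_smul,
          (hstab (e.symm (SemidirectProduct.inr y))).2 (by simp)]
      · simp [f, ι]
    obtain ⟨s, hs, hsω, hsr⟩ := hstar.exists_mem_stabilizer f (ι b • ω) hsurj S hrS
    have hfix : ((ι b)⁻¹ * s * ι b) • ω = ω := by
      rw [mul_smul, mul_smul, hsω, inv_smul_smul]
    obtain ⟨y, hy⟩ := (hstab _).1 hfix
    -- `s` lies in `b P b⁻¹` and has the same image in `P` as `r`, which forces `s = b r b⁻¹`.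
    have hyr : y = r := by
      have := congrArg SemidirectProduct.rightHom hy
      simpa [ι, f] using this.trans (by simpa [ι, f] using hsr)
    subst hyr
    have hs' : s = ι b * e.symm (SemidirectProduct.inr y) * (ι b)⁻¹ := by
      rw [hy]; simp [mul_assoc]
    have hmem := (S : Subgroup G).mul_mem hs ((S : Subgroup G).inv_mem hrS)
    have hEq : ι (b * (translation φ y b)⁻¹) = s * (e.symm (SemidirectProduct.inr y))⁻¹ := by
      rw [hs']
      apply e.injective
      simp only [ι, map_mul, map_inv, MonoidHom.comp_apply, MulEquiv.toMonoidHom_eq_coe,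
        MonoidHom.coe_coe, MulEquiv.apply_symm_apply, SemidirectProduct.inl_aut]
      group
    exact (hEq ▸ hmem : ι (b * (translation φ y b)⁻¹) ∈ (S : Subgroup G))
  have hcore : D.normalCore = ⊥ :=
    normal_isPGroup_eq_bot hT φ D.normalCore (hD.to_le D.normalCore_le)
  ext1 b
  -- The identity `[ab, r] [a, r]⁻¹ = a [b, r] a⁻¹` puts every conjugate of `[b, r]` in `D`.
  have hb : b * (translation φ r b)⁻¹ ∈ D.normalCore := by
    intro a
    have h := D.mul_mem (key (a * b)) (D.inv_mem (key a))
    rw [map_mul] at h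
    convert h using 1
    group
  rw [hcore, Subgroup.mem_bot, mul_inv_eq_one] at hb
  exact hb.symm

end TwistedWreath

theorem mainTheorem6 {G Ω : Type*} [Group G] [Finite G] [Finite Ω] [MulAction G Ω]
    (hG : IsPrimitiveOfTwistedWreathType G Ω) (p : ℕ) (hp : p.Prime) (hpΩ : p ∣ Nat.card Ω) :
    ¬ HasPropertyStar p G Ω := by
  intro hstar
  obtain ⟨-, hprim, k, -, T, _, P, i, φ, hsimple, hT, htrans, hφ, e, ω, hω⟩ := hG
  have : Fact p.Prime := ⟨hp⟩
  have : Finite (TwistedWreathProduct φ) := Finite.of_equiv G e.toEquiv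
  have : Finite (TwistedWreath.base φ) :=
    Finite.of_injective _ (SemidirectProduct.inl_injective (φ := TwistedWreath.translation φ))
  have : Finite T := Finite.of_surjective _ (TwistedWreath.eval_surjective φ 1)
  have hcard : Nat.card Ω = Nat.card (TwistedWreath.base φ) := by
    have h1 : Nat.card Ω * Nat.card (MulAction.stabilizer G ω) = Nat.card G := by
      rw [← MulAction.index_stabilizer_of_transitive G ω, Subgroup.index_mul_card]
    have h2 : Nat.card (MulAction.stabilizer G ω) = Nat.card P := by
      rw [← Subgroup.card_map_of_injective (f := e.toMonoidHom) e.injective, hω,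
        Nat.card_congr (MonoidHom.ofInjective
          (SemidirectProduct.inr_injective (φ := TwistedWreath.translation φ))).toEquiv]
    rw [h2, Nat.card_congr e.toEquiv, SemidirectProduct.card] at h1
    exact Nat.eq_of_mul_eq_mul_right Nat.card_pos h1
  have hpT : p ∣ Nat.card T := by
    have h := (hcard ▸ hpΩ).trans (Subgroup.card_subgroup_dvd_card (TwistedWreath.base φ))
    rw [Nat.card_fun] at h
    exact hp.dvd_of_dvd_pow h
  obtain ⟨r, hr⟩ := exists_prime_orderOf_dvd_card' p
    (hpT.trans (TwistedWreath.card_dvd_card_of_conj_range_le hT φ hφ))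
  have htriv := TwistedWreath.translation_eq_one_of_hasPropertyStar hT φ e ω hω hstar
    (r := r) ⟨1, by rw [pow_one, ← hr, pow_orderOf_eq_one]⟩
  have hr1 : r = 1 := by
    ext j
    obtain ⟨x, rfl⟩ := MulAction.exists_smul_eq P i j
    -- `x⁻¹ r x` fixes `i`, that is, `r` fixes `j = x • i`.
    have h := TwistedWreath.mem_of_translation_eq_one φ htriv x
    rw [MulAction.mem_stabilizer_iff, mul_smul, mul_smul, inv_smul_eq_iff] at h
    exact congrArg Fin.val h
  rw [hr1, orderOf_one] at hr
  exact hp.one_lt.ne hr
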